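/- Let $\mathbb{K}$ be an arbitrary field, $G$ an abelian group (written multiplicatively) and $g\in G$ with $g^2\ne 1$. Let $\mathrm{UT}_n^{(-)}$ be the Lie algebra of $n\times n$ upper triangular matrices over $\mathbb{K}$ with the commutator bracket, and let $\Gamma(g,g^{-1})$ be the $G$-grading on $\mathrm{UT}_3^{(-)}$ in which the matrix units are homogeneous with $\deg e_{ii}=1$, $\deg e_{12}=g$, $\deg e_{23}=g^{-1}$, $\deg e_{13}=1$; its support is $\{1,g,g^{-1}\}$. Let $\mathcal{L}(X^G)$ be the free $G$-graded Lie algebra over $\mathbb{K}$ on the variables $x_{i,h}$ ($i\in\mathbb{N}$, $h\in G$), write $y_i=x_{i,1}$, and let $\mathcal{L}(Y)$ be the subalgebra generated by the $y_i$. Commutators are left normed, and $[a,b^{(m)}]=[a,b,\ldots,b]$ with $b$ repeated $m$ times. A $T_G$-ideal is an ideal of $\mathcal{L}(X^G)$ stable under all graded endomorphisms. The $T_G$-ideal $\mathrm{Id}_G(\mathrm{UT}_3^{(-)},\Gamma(g,g^{-1}))$ of graded identities consists of the elements annihilated by all graded homomorphisms $\mathcal{L}(X^G)\to\mathrm{UT}_3^{(-)}$.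 Finally, $\mathrm{Id}(\mathrm{UT}_2^{(-)})\cap\mathcal{L}(Y)$ denotes the ordinary polynomial identities of $\mathrm{UT}_2^{(-)}$ written in the variables $y_i$. (a) If $\mathbb{K}$ is infinite, then $\mathrm{Id}_G(\mathrm{UT}_3^{(-)},\Gamma(g,g^{-1}))$ is generated, as a $T_G$-ideal, by (i) $x_{1,l}$, for $l\notin\{1,g,g^{-1}\}$; (ii) $[x_{1,l},x_{2,l}]$, for $l\in\{g,g^{-1}\}$; (iii) $[x_{1,l},x_{1,h},x_{2,l}]$, for $l,h\in\{g,g^{-1}\}$, $l\ne h$; (iv) $[y_1,y_2,x_{1,l}]$, for $l\in\{g,g^{-1}\}$; (v) $\mathrm{Id}(\mathrm{UT}_2^{(-)})\cap\mathcal{L}(Y)$. (b) If $\mathbb{K}$ is finite with $q$ elements, then $\mathrm{Id}_G(\mathrm{UT}_3^{(-)},\Gamma(g,g^{-1}))$ is generated, as a $T_G$-ideal, by (i)–(v) together with (vi) $[x_{1,l},y_1^{(q)}]-[x_{1,l},y_1]$, for $l\in\{g,g^{-1}\}$. (c) For every field $\mathbb{K}$ and every family of polynomials in $\mathcal{L}(Y)$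 which represents a basis of the relatively free algebra $\mathcal{L}(Y)/(\mathrm{Id}(\mathrm{UT}_2^{(-)})\cap\mathcal{L}(Y))$, that family together with all the polynomials $$[x_{i,l},y_{k_1}^{(p_1)},\ldots,y_{k_r}^{(p_r)}],\qquad [[x_{i,g},y_{k_1}^{(p_1)},\ldots,y_{k_r}^{(p_r)}],[x_{j,g^{-1}},y_{m_1}^{(q_1)},\ldots,y_{m_s}^{(q_s)}]],$$ where $l\in\{g,g^{-1}\}$, $i,j\in\mathbb{N}$, $r,s\ge 0$, $k_1<\cdots<k_r$, $m_1<\cdots<m_s$, $0<p_\nu<|\mathbb{K}|$ for $1\le\nu\le r$ and $0<q_\nu<|\mathbb{K}|$ for $1\le\nu\le s$ (no upper restriction if $\mathbb{K}$ is infinite), represents a basis of the relatively free algebra $\mathcal{L}(X^G)/\mathrm{Id}_G(\mathrm{UT}_3^{(-)},\Gamma(g,g^{-1}))$. -/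

import Mathlib

namespace GradedLiePI

attribute [local instance 100] LieRing.ofAssociativeRing

section FreeGraded

variable (K : Type*) [Field K] (G : Type*)

/-- The free `G`-graded Lie algebra `L(X^G)` on the variables `x_{i,h}`, `i ∈ ℕ`, `h ∈ G`. -/
abbrev FreeGraded : Type _ := FreeLieAlgebra K (ℕ × G)

variable {G}

/-- The variable `x_{i,h}`. -/
noncomputable def x (i : ℕ) (h : G) : FreeGraded K G := FreeLieAlgebra.of K (i, h)

/-- The neutral variable `y_i = x_{i,1}`. -/
noncomputable def y (G : Type*) [CommGroup G] (i : ℕ) : FreeGraded K G := x K i 1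

variable {K}

/-- Homogeneous elements of the free graded Lie algebra: the smallest family of subspaces indexed
by `G` such that `x_{i,h}` lies in degree `h` and the bracket is compatible with degrees. -/
inductive IsHomogeneous [CommGroup G] : G → FreeGraded K G → Prop
  | var (i : ℕ) (h : G) : IsHomogeneous h (x K i h)
  | zero (h : G) : IsHomogeneous h 0
  | add {h : G} {a b : FreeGraded K G} :
      IsHomogeneous h a → IsHomogeneous h b → IsHomogeneous h (a + b)
  | smul {h : G} (c : K) {a : FreeGraded K G} : IsHomogeneous h a → IsHomogeneous h (c • a)
  | lie {h k : G} {a b : FreeGraded K G} :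
      IsHomogeneous h a → IsHomogeneous k b → IsHomogeneous (h * k) ⁅a, b⁆

variable (K G)

/-- The homogeneous component of degree `h` of the free graded Lie algebra. -/
def freeComponent [CommGroup G] (h : G) : Submodule K (FreeGraded K G) where
  carrier := {a | IsHomogeneous h a}
  zero_mem' := .zero h
  add_mem' := .add
  smul_mem' c _ := .smul c

variable {K G}

/-- A homomorphism from the free graded Lie algebra to a Lie algebra `L` with grading `A` is graded
when it sends each variable `x_{i,h}` into `A h`. -/
def IsGradedHom {L : Type*} [LieRing L] [LieAlgebra K L] (A : G → Submodule K L)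
    (φ : FreeGraded K G →ₗ⁅K⁆ L) : Prop :=
  ∀ (i : ℕ) (h : G), φ (x K i h) ∈ A h

/-- `Id_G(L, A)`: the graded polynomial identities of a Lie algebra `L` with grading `A`. -/
def gradedId {L : Type*} [LieRing L] [LieAlgebra K L] (A : G → Submodule K L) :
    LieIdeal K (FreeGraded K G) where
  carrier := {f | ∀ φ : FreeGraded K G →ₗ⁅K⁆ L, IsGradedHom A φ → φ f = 0}
  zero_mem' φ _ := map_zero φ
  add_mem' ha hb φ hφ := by rw [map_add, ha φ hφ, hb φ hφ, add_zero]
  smul_mem' c a ha φ hφ := by rw [map_smul, ha φ hφ, smul_zero]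
  lie_mem {a b} hb φ hφ := by rw [LieHom.map_lie, hb φ hφ, lie_zero]

/-- A `T_G`-ideal is an ideal stable under all graded endomorphisms. -/
def IsTIdeal [CommGroup G] (I : LieIdeal K (FreeGraded K G)) : Prop :=
  ∀ φ : FreeGraded K G →ₗ⁅K⁆ FreeGraded K G, IsGradedHom (freeComponent K G) φ →
    ∀ f ∈ I, φ f ∈ I

/-- The `T_G`-ideal generated by a set `S`. -/
noncomputable def tIdealSpan [CommGroup G] (S : Set (FreeGraded K G)) : LieIdeal K (FreeGraded K G) :=
  sInf {I | IsTIdeal I ∧ S ⊆ I}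

/-- The ordinary polynomial identities of a Lie algebra `L`, in the variables indexed by `ℕ`. -/
def ordinaryId (K : Type*) [Field K] (L : Type*) [LieRing L] [LieAlgebra K L] :
    LieIdeal K (FreeLieAlgebra K ℕ) where
  carrier := {f | ∀ φ : FreeLieAlgebra K ℕ →ₗ⁅K⁆ L, φ f = 0}
  zero_mem' φ := map_zero φ
  add_mem' ha hb φ := by rw [map_add, ha φ, hb φ, add_zero]
  smul_mem' c a ha φ := by rw [map_smul, ha φ, smul_zero]
  lie_mem {a b} hb φ := by rw [LieHom.map_lie, hb φ, lie_zero]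

/-- The embedding of the free Lie algebra `L(Y)`, on the neutral variables, in `L(X^G)`. -/
noncomputable def neutral (K : Type*) [Field K] (G : Type*) [CommGroup G] :
    FreeLieAlgebra K ℕ →ₗ⁅K⁆ FreeGraded K G :=
  FreeLieAlgebra.lift K (fun i => y K G i)

end FreeGraded

section UpperTriangular

/-- The Lie algebra `UT_n^{(-)}` of upper triangular matrices of order `n`. -/
def UT (n : ℕ) (K : Type*) [Field K] : LieSubalgebra K (Matrix (Fin n) (Fin n) K) where
  carrier := {A | A.IsUpperTriangular}
  zero_mem' := Matrix.blockTriangular_zero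
  add_mem' ha hb := Matrix.BlockTriangular.add ha hb
  smul_mem' c a ha i j hij := by rw [Matrix.smul_apply, ha hij, smul_zero]
  lie_mem' ha hb :=
    Matrix.BlockTriangular.sub (Matrix.BlockTriangular.mul ha hb) (Matrix.BlockTriangular.mul hb ha)

variable {G : Type*} [CommGroup G]

/-- The degree of the matrix unit `e_{ij}` (`i ≤ j`) of `UT_3` in the elementary grading `Γ(g, h)`:
`deg e_{ii} = 1`, `deg e_{12} = g`, `deg e_{23} = h`, `deg e_{13} = g h`. -/
def unitDegree (g h : G) (i j : Fin 3) : G := (![1, g, g * h] i)⁻¹ * ![1, g, g * h] j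

/-- The homogeneous component of degree `k` of the elementary grading `Γ(g, h)` on `UT_3^{(-)}`:
the span of the `e_{ij}`, `i ≤ j`, of degree `k`. -/
def Gamma (K : Type*) [Field K] (g h : G) (k : G) : Submodule K (UT 3 K) where
  carrier := {A | ∀ i j, unitDegree g h i j ≠ k → A.1 i j = 0}
  zero_mem' _ _ _ := rfl
  add_mem' {a b} ha hb i j hij := by
    change a.1 i j + b.1 i j = 0
    rw [ha i j hij, hb i j hij, add_zero]
  smul_mem' c a ha i j hij := by
    change c * a.1 i j = 0
    rw [ha i j hij, mul_zero]

/-- The support of a grading. -/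
def support {K : Type*} [Field K] {L : Type*} [LieRing L] [LieAlgebra K L]
    (A : G → Submodule K L) : Set G :=
  {k | A k ≠ ⊥}

end UpperTriangular

section Polynomials

/-- `[a, b^{(m)}] = [a, b, …, b]`, with `b` repeated `m` times (commutators are left normed). -/
def lieIter {L : Type*} [LieRing L] (a b : L) (m : ℕ) : L := (fun c => ⁅c, b⁆)^[m] a

/-- `[a, y_0^{(p 0)}, y_1^{(p 1)}, y_2^{(p 2)}, …]` for a finitely supported sequence `p` of
exponents, the neutral variables appearing in increasing order. -/
noncomputable def yComm {K : Type*} [Field K] {G : Type*} [CommGroup G] (a : FreeGraded K G)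
    (p : ℕ →₀ ℕ) : FreeGraded K G :=
  (p.support.sort (· ≤ ·)).foldl (fun c i => lieIter c (y K G i) (p i)) a

/-- Finitely supported sequences of exponents `p` with `0 ≤ p i < |K|`. -/
abbrev Exponents (K : Type*) : Type := {p : ℕ →₀ ℕ // ∀ i, (p i : ℕ∞) < ENat.card K}

variable (K : Type*) [Field K] {G : Type*} [CommGroup G] (g : G)

/-- The graded polynomials which generate the identities of `Γ(g, g⁻¹)` over any field. -/
def generators : Set (FreeGraded K G) :=
  {f | ∃ l, l ∉ support (Gamma K g g⁻¹) ∧ f = x K 1 l} ∪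
  {f | ∃ l ∈ ({g, g⁻¹} : Set G), f = ⁅x K 1 l, x K 2 l⁆} ∪
  {f | ∃ l ∈ ({g, g⁻¹} : Set G), ∃ h ∈ ({g, g⁻¹} : Set G), l ≠ h ∧
    f = ⁅⁅x K 1 l, x K 1 h⁆, x K 2 l⁆} ∪
  {f | ∃ l ∈ ({g, g⁻¹} : Set G), f = ⁅⁅y K G 1, y K G 2⁆, x K 1 l⁆} ∪
  neutral K G '' (ordinaryId K (UT 2 K) : Set (FreeLieAlgebra K ℕ))

/-- The additional generators over a field with `q` elements. -/
def finiteGenerators (q : ℕ) : Set (FreeGraded K G) :=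
  {f | ∃ l ∈ ({g, g⁻¹} : Set G), f = lieIter (x K 1 l) (y K G 1) q - ⁅x K 1 l, y K G 1⁆}

/-- The family of the polynomials `[x_{i,l}, y_1^{(p_1)}, …, y_r^{(p_r)}]`, `l ∈ {g, g⁻¹}`, the
polynomials `[[x_{i,g}, y_1^{(p_1)}, …, y_r^{(p_r)}], [x_{j,g⁻¹}, y_1^{(q_1)}, …, y_r^{(q_r)}]]`,
and the given polynomials `b` in the neutral variables. -/
noncomputable def basisFamily {ι : Type*} (b : ι → FreeLieAlgebra K ℕ) :
    (({l : G // l ∈ ({g, g⁻¹} : Set G)} × ℕ × Exponents K) ⊕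
      ((ℕ × Exponents K) × (ℕ × Exponents K))) ⊕ ι → FreeGraded K G
  | .inl (.inl (l, i, p)) => yComm (x K i l.1) p.1
  | .inl (.inr ((i, p), (j, q))) => ⁅yComm (x K i g) p.1, yComm (x K j g⁻¹) q.1⁆
  | .inr t => neutral K G (b t)

end Polynomials

/-- The elements of the family `b` represent a basis of `V / W`. -/
def IsBasisModulo {K V ι : Type*} [Field K] [AddCommGroup V] [Module K V] (W : Submodule K V)
    (b : ι → V) : Prop :=
  LinearIndependent K (fun t => W.mkQ (b t)) ∧
    Submodule.span K (Set.range fun t => W.mkQ (b t)) = ⊤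

end GradedLiePI

/-!
The graded identities of `Γ(g, g⁻¹)` and the T-ideal `T` generated by the listed polynomials are
compared through the family `basisFamily`: it spans the free algebra modulo `T`, it is linearly
independent modulo the identities, and `T` consists of identities. Hence an identity is congruent
modulo `T` to a combination of the family, which is again an identity and so has zero coefficients;
this gives the equality of the two ideals (`gradedId_eq_of_containsConsequences`) and the basis at
once.

Spanning (`ContainsConsequences.span_basisFamily`). Modulo `T` a variable whose degree is outside
`{1, g, g⁻¹}` vanishes, two elements of the same degree `g^{±1}` commute, and a commutator of
elements of degrees `g` and `g⁻¹` is killed by any element of degree `g^{±1}`. By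
`[y_1, y_2, x_{1,l}] = 0` the operators `[·, y_k]` commute on elements of degree `l = g^{±1}`, so the
neutral variables in a commutator can be sorted; over a field with `q` elements
`[x_{1,l}, y_1^{(q)}] = [x_{1,l}, y_1]` brings their exponents below `q`
(`ContainsConsequences.lie_y_mem_yCommSpan`). Therefore the span of the family is closed under
bracketing with variables, and it contains the variables.

Independence (`linearIndependent_basisFamily`). Killing the variables of degree different from `1`
maps identities to identities of `UT_2`, which separates the polynomials in the `y_i`. For the
remaining polynomials let `x_{i,g} = a_i e_12`, `x_{i,g⁻¹} = b_i e_23` and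
`y_i = t_i e_33 - s_i e_11`. Then `[x_{i,g}, y^{(p)}] = a_i s^p e_12`,
`[x_{j,g⁻¹}, y^{(q)}] = b_j t^q e_23`, and the bracket of these is `a_i b_j s^p t^q e_13`, while
polynomials in the `y_i` take diagonal values. Monomial functions with all exponents less than `|K|`
are linearly independent (`linearIndependent_monomialFun`), which proves the claim.
-/

namespace GradedLiePI

attribute [local instance 100] LieRing.ofAssociativeRing

/-! ### Free Lie algebras and iterated commutators -/

section Iterated

theorem freeLie_induction {K X : Type*} [Field K] {P : FreeLieAlgebra K X → Prop}
    (of : ∀ z, P (FreeLieAlgebra.of K z)) (zero : P 0) (add : ∀ a b, P a → P b → P (a + b))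
    (smul : ∀ (c : K) a, P a → P (c • a)) (lie : ∀ a b, P a → P b → P ⁅a, b⁆)
    (u : FreeLieAlgebra K X) : P u := by
  let S : LieSubalgebra K (FreeLieAlgebra K X) :=
    { carrier := {u | P u}
      zero_mem' := zero
      add_mem' := fun ha hb => add _ _ ha hb
      smul_mem' := fun c a ha => smul c a ha
      lie_mem' := fun ha hb => lie _ _ ha hb }
  let f : FreeLieAlgebra K X →ₗ⁅K⁆ S :=
    FreeLieAlgebra.lift K fun z => (⟨FreeLieAlgebra.of K z, of z⟩ : S)
  have hf : S.incl.comp f = LieHom.id := by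
    ext z
    simp [f]
  have hu : ((f u : S) : FreeLieAlgebra K X) = u := LieHom.congr_fun hf u
  exact hu ▸ (f u).2

/-- The elements that normalize a subspace form a subalgebra, so it is enough to test generators. -/
theorem lie_mem_of_generators {K X Q : Type*} [Field K] [LieRing Q] [LieAlgebra K Q]
    (φ : FreeLieAlgebra K X →ₗ⁅K⁆ Q) (S : Submodule K Q)
    (h : ∀ z, ∀ s ∈ S, ⁅s, φ (FreeLieAlgebra.of K z)⁆ ∈ S) (u : FreeLieAlgebra K X) :
    ∀ s ∈ S, ⁅s, φ u⁆ ∈ S := by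
  induction u using freeLie_induction with
  | of z => exact h z
  | zero => intro s _; simp
  | add a b ha hb => intro s hs; rw [map_add, lie_add]; exact S.add_mem (ha s hs) (hb s hs)
  | smul c a ha => intro s hs; rw [map_smul, lie_smul]; exact S.smul_mem c (ha s hs)
  | lie a b ha hb =>
    intro s hs
    rw [LieHom.map_lie, leibniz_lie, ← lie_skew (φ a) ⁅s, φ b⁆, ← sub_eq_add_neg]
    exact S.sub_mem (hb _ (ha s hs)) (ha _ (hb s hs))

variable {L L' : Type*} [LieRing L] [LieRing L']

theorem lieIter_succ (a b : L) (m : ℕ) : lieIter a b (m + 1) = ⁅lieIter a b m, b⁆ :=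
  Function.iterate_succ_apply' _ _ _

theorem map_lieIter {K : Type*} [Field K] [LieAlgebra K L] [LieAlgebra K L'] (φ : L →ₗ⁅K⁆ L')
    (a b : L) (m : ℕ) : φ (lieIter a b m) = lieIter (φ a) (φ b) m := by
  induction m with
  | zero => rfl
  | succ m ih => rw [lieIter_succ, lieIter_succ, LieHom.map_lie, ih]

/-- The commutator `[a, Y_0^{(p 0)}, …, Y_{n-1}^{(p (n-1))}]` in any Lie ring. Unlike `yComm`, it
runs over an initial segment of `ℕ`, zero exponents included, and so allows induction on `n`. -/
def iterLie (Y : ℕ → L) (p : ℕ → ℕ) (a : L) : ℕ → L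
  | 0 => a
  | n + 1 => lieIter (iterLie Y p a n) (Y n) (p n)

theorem map_iterLie {K : Type*} [Field K] [LieAlgebra K L] [LieAlgebra K L'] (φ : L →ₗ⁅K⁆ L')
    (Y : ℕ → L) (p : ℕ → ℕ) (a : L) (n : ℕ) :
    φ (iterLie Y p a n) = iterLie (fun k => φ (Y k)) p (φ a) n := by
  induction n with
  | zero => rfl
  | succ n ih => simp only [iterLie, map_lieIter, ih]

theorem iterLie_eq_foldl (Y : ℕ → L) (p : ℕ → ℕ) (a : L) (n : ℕ) :
    iterLie Y p a n = (List.range n).foldl (fun c i => lieIter c (Y i) (p i)) a := by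
  induction n with
  | zero => rfl
  | succ n ih => simp [List.range_succ, iterLie, ih]

theorem yComm_eq_iterLie {K G : Type*} [Field K] [CommGroup G] (a : FreeGraded K G) (p : ℕ →₀ ℕ)
    {n : ℕ} (hn : p.support ⊆ Finset.range n) : yComm a p = iterLie (y K G) p a n := by
  have hs : p.support.sort (· ≤ ·) = (List.range n).filter (fun k => p k ≠ 0) := by
    refine List.Perm.eq_of_sortedLE (Finset.sortedLT_sort _).sortedLE
      ((List.pairwise_le_range (n := n)).filter _).sortedLE ?_
    rw [List.perm_ext_iff_of_nodup (Finset.sort_nodup _ _) (List.nodup_range.filter _)]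
    intro k
    have := @hn k
    simp only [Finset.mem_sort, List.mem_filter, List.mem_range, Finsupp.mem_support_iff,
      Finset.mem_range] at this ⊢
    simpa using this
  rw [iterLie_eq_foldl, yComm, hs, List.foldl_filter]
  congr 1
  funext c k
  by_cases hk : p k = 0
  · simp [hk, lieIter]
  · simp [hk]

theorem exists_support_subset_range (p : ℕ →₀ ℕ) (m : ℕ) :
    ∃ n, m ≤ n ∧ p.support ⊆ Finset.range n :=
  ⟨max m (p.support.sup id + 1), le_max_left _ _, fun _ hk => Finset.mem_range.2
    (lt_max_of_lt_right (Nat.lt_succ_of_le (Finset.le_sup (f := id) hk)))⟩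

end Iterated

section Commuting

/-! The operators `[·, Y_k]` preserve a set `N` and commute on it. -/

variable {Q : Type*} [LieRing Q] {Y : ℕ → Q} {N : Set Q}

theorem lieIter_mem (hN : ∀ a ∈ N, ∀ k, ⁅a, Y k⁆ ∈ N) {a : Q} (ha : a ∈ N) (k m : ℕ) :
    lieIter a (Y k) m ∈ N := by
  induction m with
  | zero => exact ha
  | succ m ih => rw [lieIter_succ]; exact hN _ ih k

theorem iterLie_mem (hN : ∀ a ∈ N, ∀ k, ⁅a, Y k⁆ ∈ N) {a : Q} (ha : a ∈ N) (p : ℕ → ℕ) (n : ℕ) :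
    iterLie Y p a n ∈ N := by
  induction n with
  | zero => exact ha
  | succ n ih => exact lieIter_mem hN ih _ _

theorem lie_lieIter_comm (hN : ∀ a ∈ N, ∀ k, ⁅a, Y k⁆ ∈ N)
    (hcomm : ∀ a ∈ N, ∀ i j, ⁅⁅a, Y i⁆, Y j⁆ = ⁅⁅a, Y j⁆, Y i⁆) {a : Q} (ha : a ∈ N)
    (i j m : ℕ) : ⁅lieIter a (Y i) m, Y j⁆ = lieIter ⁅a, Y j⁆ (Y i) m := by
  induction m with
  | zero => rfl
  | succ m ih => rw [lieIter_succ, lieIter_succ, hcomm _ (lieIter_mem hN ha i m), ih]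

/-- Bracketing with `Y_k` raises the exponent of `Y_k` by one. -/
theorem lie_iterLie (hN : ∀ a ∈ N, ∀ k, ⁅a, Y k⁆ ∈ N)
    (hcomm : ∀ a ∈ N, ∀ i j, ⁅⁅a, Y i⁆, Y j⁆ = ⁅⁅a, Y j⁆, Y i⁆) {a : Q} (ha : a ∈ N)
    (p : ℕ → ℕ) {k n : ℕ} (hk : k < n) :
    ⁅iterLie Y p a n, Y k⁆ = iterLie Y (Function.update p k (p k + 1)) a n := by
  -- The factors before `Y_k` are unaffected by the change of the exponent at `k`.
  have low : ∀ m ≤ k, iterLie Y (Function.update p k (p k + 1)) a m = iterLie Y p a m := by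
    intro m
    induction m with
    | zero => intro _; rfl
    | succ m ih =>
      intro hm
      simp only [iterLie]
      rw [ih (by omega), Function.update_of_ne (by omega)]
  induction n, hk using Nat.le_induction with
  | base => simp only [iterLie]; rw [low k le_rfl, Function.update_self, lieIter_succ]
  | succ n hn ih =>
    simp only [iterLie]
    rw [lie_lieIter_comm hN hcomm (iterLie_mem hN ha p n), ih, Function.update_of_ne (by omega)]

/-- Exponents may be replaced one by one by others that act in the same way on `N`. -/
theorem iterLie_congr (hN : ∀ a ∈ N, ∀ k, ⁅a, Y k⁆ ∈ N) {a : Q} (ha : a ∈ N) {p p' : ℕ → ℕ}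
    (h : ∀ k, ∀ w ∈ N, lieIter w (Y k) (p k) = lieIter w (Y k) (p' k)) (n : ℕ) :
    iterLie Y p a n = iterLie Y p' a n := by
  induction n with
  | zero => rfl
  | succ n ih =>
    simp only [iterLie]
    rw [h n _ (iterLie_mem hN ha p n), ih]

end Commuting

/-! ### Substitutions in T-ideals -/

section TIdeal

variable {K G : Type*} [Field K] [CommGroup G]

/-- A substitution which replaces each variable by a homogeneous element of the same degree. -/
def IsGradedSubst (v : ℕ × G → FreeGraded K G) : Prop := ∀ i h, IsHomogeneous h (v (i, h))

theorem isGradedSubst_of : IsGradedSubst (FreeLieAlgebra.of K : ℕ × G → FreeGraded K G) :=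
  fun i h => .var i h

theorem IsGradedSubst.update [DecidableEq (ℕ × G)] {v : ℕ × G → FreeGraded K G}
    (hv : IsGradedSubst v) (i : ℕ) {h : G} {a : FreeGraded K G} (ha : IsHomogeneous h a) :
    IsGradedSubst (Function.update v (i, h) a) := by
  intro j k
  by_cases hjk : (j, k) = (i, h)
  · obtain ⟨rfl, rfl⟩ := Prod.mk.inj hjk
    simpa using ha
  · simpa [Function.update_of_ne hjk] using hv j k

theorem mem_tIdealSpan {S : Set (FreeGraded K G)} {f : FreeGraded K G} :
    f ∈ tIdealSpan S ↔ ∀ I : LieIdeal K (FreeGraded K G), IsTIdeal I → S ⊆ I → f ∈ I := by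
  rw [tIdealSpan, ← SetLike.mem_coe, LieSubmodule.coe_sInf, Set.mem_iInter₂]
  exact ⟨fun h I h1 h2 => h I ⟨h1, h2⟩, fun h I hI => h I hI.1 hI.2⟩

theorem lift_mem_tIdealSpan {S : Set (FreeGraded K G)} {v : ℕ × G → FreeGraded K G}
    (hv : IsGradedSubst v) {f : FreeGraded K G} (hf : f ∈ S) :
    FreeLieAlgebra.lift K v f ∈ tIdealSpan S := by
  refine mem_tIdealSpan.2 fun I hI hS => ?_
  refine hI _ (fun i h => ?_) f (hS hf)
  rw [x, FreeLieAlgebra.lift_of_apply]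
  exact hv i h

theorem subset_tIdealSpan {S : Set (FreeGraded K G)} {f : FreeGraded K G} (hf : f ∈ S) :
    f ∈ tIdealSpan S :=
  mem_tIdealSpan.2 fun _ _ hS => hS hf

theorem tIdealSpan_le {S : Set (FreeGraded K G)} {I : LieIdeal K (FreeGraded K G)}
    (hI : IsTIdeal I) (hS : S ⊆ I) : tIdealSpan S ≤ I :=
  fun _ hf => mem_tIdealSpan.1 hf I hI hS

end TIdeal

/-! ### Spanning -/

section Spanning

variable {K G : Type*} [Field K] [CommGroup G]

/-- The ideal `I` contains every consequence of the generators of the identities of `Γ(g, g⁻¹)`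
that is obtained by replacing variables by homogeneous elements. -/
structure ContainsConsequences (g : G) (I : LieIdeal K (FreeGraded K G)) : Prop where
  x_mem : ∀ l, l ≠ 1 → l ∉ ({g, g⁻¹} : Set G) → ∀ i, x K i l ∈ I
  lie_mem : ∀ l ∈ ({g, g⁻¹} : Set G), ∀ a b : FreeGraded K G,
    IsHomogeneous l a → IsHomogeneous l b → ⁅a, b⁆ ∈ I
  lie_lie_mem : ∀ l ∈ ({g, g⁻¹} : Set G), ∀ h ∈ ({g, g⁻¹} : Set G), l ≠ h → ∀ a b c : FreeGraded K G,
    IsHomogeneous l a → IsHomogeneous h b → IsHomogeneous l c → ⁅⁅a, b⁆, c⁆ ∈ I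
  y_lie_mem : ∀ l ∈ ({g, g⁻¹} : Set G), ∀ i j, ∀ a : FreeGraded K G, IsHomogeneous l a →
    ⁅⁅y K G i, y K G j⁆, a⁆ ∈ I
  neutral_mem : ∀ u ∈ ordinaryId K (UT 2 K), neutral K G u ∈ I
  lieIter_mem : Finite K → ∀ l ∈ ({g, g⁻¹} : Set G), ∀ k, ∀ a : FreeGraded K G,
    IsHomogeneous l a →
    lieIter a (y K G k) (Nat.card K) - ⁅a, y K G k⁆ ∈ I

/-- The projection onto the quotient by an ideal, as a homomorphism of Lie algebras. -/
def quotientHom {L : Type*} [LieRing L] [LieAlgebra K L] (I : LieIdeal K L) : L →ₗ⁅K⁆ L ⧸ I :=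
  { I.toSubmodule.mkQ with map_lie' := fun {a b} => LieSubmodule.Quotient.mk_bracket (I := I) a b }

theorem quotientHom_eq_zero {L : Type*} [LieRing L] [LieAlgebra K L] {I : LieIdeal K L} {a : L} :
    quotientHom I a = 0 ↔ a ∈ I :=
  LieSubmodule.Quotient.mk_eq_zero I

theorem quotientHom_eq {L : Type*} [LieRing L] [LieAlgebra K L] {I : LieIdeal K L} {a b : L} :
    quotientHom I a = quotientHom I b ↔ a - b ∈ I := by
  rw [← sub_eq_zero, ← map_sub, quotientHom_eq_zero]

/-- The span, modulo `I`, of the elements `[a, y_0^{(p 0)}, y_1^{(p 1)}, …]`. -/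
noncomputable def yCommSpan (I : LieIdeal K (FreeGraded K G)) (a : FreeGraded K G) :
    Submodule K (FreeGraded K G ⧸ I) :=
  Submodule.span K (Set.range fun p : Exponents K => quotientHom I (yComm a p.1))

theorem zero_lt_card (K : Type*) [Field K] (i : ℕ) :
    (((0 : ℕ →₀ ℕ) i : ℕ) : ℕ∞) < ENat.card K := by
  simp

theorem mem_yCommSpan_self (I : LieIdeal K (FreeGraded K G)) (a : FreeGraded K G) :
    quotientHom I a ∈ yCommSpan I a :=
  Submodule.subset_span ⟨⟨0, zero_lt_card K⟩, by simp [yComm]⟩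

theorem update_lt_card {K : Type*} {p : ℕ →₀ ℕ} (hp : ∀ i, (p i : ℕ∞) < ENat.card K) {k m : ℕ}
    (hm : (m : ℕ∞) < ENat.card K) (i : ℕ) : ((p.update k m i : ℕ) : ℕ∞) < ENat.card K := by
  classical
  rw [Finsupp.coe_update, Function.update_apply]
  split_ifs
  · exact hm
  · exact hp i

theorem IsHomogeneous.lie_y {l : G} {a : FreeGraded K G} (ha : IsHomogeneous l a) (k : ℕ) :
    IsHomogeneous l ⁅a, y K G k⁆ := by
  simpa [y] using ha.lie (IsHomogeneous.var (K := K) k (1 : G))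

theorem isHomogeneous_yComm {l : G} {a : FreeGraded K G} (ha : IsHomogeneous l a) (p : ℕ →₀ ℕ) :
    IsHomogeneous l (yComm a p) := by
  obtain ⟨n, -, hn⟩ := exists_support_subset_range p 0
  rw [yComm_eq_iterLie a p hn]
  exact iterLie_mem (N := {a | IsHomogeneous l a}) (fun a ha k => ha.lie_y k) ha p n

namespace ContainsConsequences

variable {g : G} {I : LieIdeal K (FreeGraded K G)}

/-- Modulo `I` the operators `[·, y_k]` commute on elements of degree `g^{±1}`, so that the neutral
variables can be sorted; over a finite field an exponent which reaches `|K|` drops to `1`. -/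
theorem lie_y_mem_yCommSpan (hI : ContainsConsequences g I) {l : G}
    (hl : l ∈ ({g, g⁻¹} : Set G)) {a : FreeGraded K G} (ha : IsHomogeneous l a) (k : ℕ) :
    ∀ s ∈ yCommSpan I a, ⁅s, quotientHom I (y K G k)⁆ ∈ yCommSpan I a := by
  classical
  intro s hs
  induction hs using Submodule.span_induction with
  | zero => simp
  | add s t _ _ hs ht => rw [add_lie]; exact Submodule.add_mem _ hs ht
  | smul c s _ hs => rw [smul_lie]; exact Submodule.smul_mem _ c hs
  | mem s hs =>
    obtain ⟨⟨p, hp⟩, rfl⟩ := hs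
    let Y : ℕ → FreeGraded K G ⧸ I := fun k => quotientHom I (y K G k)
    let N : Set (FreeGraded K G ⧸ I) := quotientHom I '' {a | IsHomogeneous l a}
    have hN : ∀ a ∈ N, ∀ k, ⁅a, Y k⁆ ∈ N := by
      rintro _ ⟨a, ha, rfl⟩ k
      exact ⟨⁅a, y K G k⁆, IsHomogeneous.lie_y ha k, LieHom.map_lie _ _ _⟩
    have hcomm : ∀ a ∈ N, ∀ i j, ⁅⁅a, Y i⁆, Y j⁆ = ⁅⁅a, Y j⁆, Y i⁆ := by
      rintro _ ⟨a, ha, rfl⟩ i j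
      simp only [Y, ← LieHom.map_lie]
      rw [quotientHom_eq]
      have h := hI.y_lie_mem l hl j i a ha
      rw [lie_lie] at h
      rw [← lie_skew ⁅a, y K G i⁆, ← lie_skew ⁅a, y K G j⁆, ← lie_skew a (y K G i),
        ← lie_skew a (y K G j)]
      simpa only [lie_neg, neg_neg] using h
    have haN : quotientHom I a ∈ N := ⟨a, ha, rfl⟩
    have hcard : 1 < ENat.card K := ENat.one_lt_card
    obtain ⟨n, hkn, hn⟩ := exists_support_subset_range p (k + 1)
    have hsupp : ∀ m, (p.update k m).support ⊆ Finset.range n := by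
      intro m i hi
      rw [Finsupp.mem_support_iff, Finsupp.coe_update, Function.update_apply] at hi
      split_ifs at hi with hik
      · rw [Finset.mem_range]; omega
      · exact hn (Finsupp.mem_support_iff.2 hi)
    -- The new exponent `p k + 1` may be replaced by any admissible `m` with the same effect.
    have key : ∀ m : ℕ, (m : ℕ∞) < ENat.card K → (∀ w ∈ N, lieIter w (Y k) (p k + 1) =
        lieIter w (Y k) m) → ⁅quotientHom I (yComm a p), Y k⁆ ∈ yCommSpan I a := by
      intro m hm hw
      refine Submodule.subset_span ⟨⟨p.update k m, update_lt_card hp hm⟩, ?_⟩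
      change quotientHom I (yComm a (p.update k m)) = _
      rw [yComm_eq_iterLie a p hn, yComm_eq_iterLie a _ (hsupp m), map_iterLie, map_iterLie,
        lie_iterLie hN hcomm haN p hkn]
      refine (iterLie_congr hN haN (fun i w hwN => ?_) n).symm
      rw [Finsupp.coe_update]
      by_cases hik : i = k
      · subst hik
        simpa using hw w hwN
      · rw [Function.update_of_ne hik, Function.update_of_ne hik]
    by_cases hpk : ((p k + 1 : ℕ) : ℕ∞) < ENat.card K
    · exact key (p k + 1) hpk fun _ _ => rfl
    · have hle : ENat.card K ≤ ((p k + 1 : ℕ) : ℕ∞) := not_lt.1 hpk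
      have hfin : Finite K := ENat.card_lt_top.1 (hle.trans_lt (ENat.natCast_lt_top _))
      have hq : Nat.card K = p k + 1 := by
        have h1 := hp k
        rw [ENat.card_eq_coe_natCard] at h1 hle
        norm_cast at h1 hle
        omega
      refine key 1 (by exact_mod_cast hcard) ?_
      rintro _ ⟨w, hw, rfl⟩
      have := quotientHom_eq.2 (hI.lieIter_mem hfin l hl k w hw)
      rw [map_lieIter, hq, LieHom.map_lie] at this
      rw [this]
      rfl

variable {ι : Type*} {b : ι → FreeLieAlgebra K ℕ}

/-- The span of the family modulo `I` contains the variables and is closed under bracketing with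
each of them, hence it is everything. -/
theorem span_basisFamily (hI : ContainsConsequences g I) (hgg : g ≠ g⁻¹)
    (hb : Submodule.span K (Set.range fun t =>
      (ordinaryId K (UT 2 K)).toSubmodule.mkQ (b t)) = ⊤) (u : FreeGraded K G) :
    quotientHom I u ∈
      Submodule.span K (Set.range fun t => quotientHom I (basisFamily K g b t)) := by
  set S := Submodule.span K (Set.range fun t => quotientHom I (basisFamily K g b t)) with hS
  have hfam : ∀ t, quotientHom I (basisFamily K g b t) ∈ S :=
    fun t => Submodule.subset_span ⟨t, rfl⟩
  have hg : g ∈ ({g, g⁻¹} : Set G) := by simp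
  have hg' : g⁻¹ ∈ ({g, g⁻¹} : Set G) := by simp
  have hone : ∀ l ∈ ({g, g⁻¹} : Set G), ∀ i, yCommSpan I (x K i l) ≤ S := by
    intro l hl i
    refine Submodule.span_le.2 ?_
    rintro _ ⟨p, rfl⟩
    exact hfam (.inl (.inl (⟨l, hl⟩, i, p)))
  have htwo : ∀ i j, ∀ s ∈ yCommSpan I (x K i g), ∀ t ∈ yCommSpan I (x K j g⁻¹),
      ⁅s, t⁆ ∈ S := by
    intro i j s hs t ht
    induction hs, ht using Submodule.span_induction₂ with
    | mem_mem s t hs ht =>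
      obtain ⟨p, rfl⟩ := hs
      obtain ⟨q, rfl⟩ := ht
      rw [← LieHom.map_lie]
      exact hfam (.inl (.inr ((i, p), (j, q))))
    | zero_left t _ => simp
    | zero_right s _ => simp
    | add_left s s' t _ _ _ h h' => rw [add_lie]; exact S.add_mem h h'
    | add_right s t t' _ _ _ h h' => rw [lie_add]; exact S.add_mem h h'
    | smul_left c s t _ _ h => rw [smul_lie]; exact S.smul_mem c h
    | smul_right c s t _ _ h => rw [lie_smul]; exact S.smul_mem c h
  have hneutral : ∀ v, quotientHom I (neutral K G v) ∈ S := by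
    intro v
    have hv : (ordinaryId K (UT 2 K)).toSubmodule.mkQ v ∈ (⊤ : Submodule K _) := trivial
    rw [← hb, Set.range_comp' _ b, ← Submodule.map_span] at hv
    obtain ⟨w, hw, hwv⟩ := hv
    have heq : quotientHom I (neutral K G v) = quotientHom I (neutral K G w) := by
      rw [quotientHom_eq, ← map_sub]
      refine hI.neutral_mem _ ?_
      exact (Submodule.Quotient.eq (ordinaryId K (UT 2 K)).toSubmodule).1 hwv.symm
    rw [heq]
    clear heq hwv
    induction hw using Submodule.span_induction with
    | zero => simp
    | add s t _ _ hs ht => simp only [map_add]; exact S.add_mem hs ht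
    | smul c s _ hs => simp only [map_smul]; exact S.smul_mem c hs
    | mem s hs => obtain ⟨t, rfl⟩ := hs; exact hfam (.inr t)
  have hvar : ∀ z, quotientHom I (FreeLieAlgebra.of K z) ∈ S := by
    rintro ⟨i, l⟩
    by_cases h1 : l = 1
    · subst h1
      have := hneutral (FreeLieAlgebra.of K i)
      rwa [neutral, FreeLieAlgebra.lift_of_apply] at this
    · by_cases hl : l ∈ ({g, g⁻¹} : Set G)
      · exact hone l hl i (mem_yCommSpan_self I _)
      · have := quotientHom_eq_zero.2 (hI.x_mem l h1 hl i)
        rw [x] at this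
        rw [this]
        exact S.zero_mem
  have hmem : ∀ (l : G) (i : ℕ) (p : ℕ →₀ ℕ), IsHomogeneous l (yComm (x K i l) p) :=
    fun l i p => isHomogeneous_yComm (.var i l) p
  -- A commutator of two elements of degrees `g` and `g⁻¹` is killed by bracketing with either
  -- degree.
  have hkill : ∀ l ∈ ({g, g⁻¹} : Set G), ∀ a b c : FreeGraded K G, IsHomogeneous g a →
      IsHomogeneous g⁻¹ b → IsHomogeneous l c → ⁅⁅a, b⁆, c⁆ ∈ I := by
    intro l hl a b c ha hb hc
    rcases hl with rfl | hl
    · exact hI.lie_lie_mem _ hg _ hg' hgg a b c ha hb hc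
    · rw [Set.mem_singleton_iff] at hl
      subst hl
      rw [← lie_skew a b, neg_lie]
      exact neg_mem (hI.lie_lie_mem _ hg' _ hg hgg.symm b a c hb ha hc)
  have hclosed : ∀ z, ∀ s ∈ S, ⁅s, quotientHom I (FreeLieAlgebra.of K z)⁆ ∈ S := by
    rintro ⟨j, h⟩ s hs
    induction hs using Submodule.span_induction with
    | zero => simp
    | add s t _ _ hs ht => rw [add_lie]; exact S.add_mem hs ht
    | smul c s _ hs => rw [smul_lie]; exact S.smul_mem c hs
    | mem s hs =>
      obtain ⟨t, rfl⟩ := hs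
      change ⁅quotientHom I (basisFamily K g b t), quotientHom I (x K j h)⁆ ∈ S
      by_cases h1 : h = 1
      · subst h1
        change ⁅_, quotientHom I (y K G j)⁆ ∈ S
        rcases t with (⟨⟨l, hl⟩, i, p⟩ | ⟨⟨i, p⟩, ⟨i', q⟩⟩) | t
        · exact hone l hl i (hI.lie_y_mem_yCommSpan hl (.var i l) j _
            (Submodule.subset_span ⟨p, rfl⟩))
        · have hA : quotientHom I (yComm (x K i g) p.1) ∈ yCommSpan I (x K i g) :=
            Submodule.subset_span ⟨p, rfl⟩
          have hB : quotientHom I (yComm (x K i' g⁻¹) q.1) ∈ yCommSpan I (x K i' g⁻¹) :=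
            Submodule.subset_span ⟨q, rfl⟩
          simp only [basisFamily, LieHom.map_lie]
          rw [lie_lie, ← lie_skew _ ⁅quotientHom I (yComm (x K i g) p.1), _⁆, sub_neg_eq_add]
          exact S.add_mem (htwo _ _ _ hA _ (hI.lie_y_mem_yCommSpan hg' (.var i' _) j _ hB))
            (htwo _ _ _ (hI.lie_y_mem_yCommSpan hg (.var i _) j _ hA) _ hB)
        · have := hneutral ⁅b t, FreeLieAlgebra.of K j⁆
          rw [LieHom.map_lie, LieHom.map_lie, neutral, FreeLieAlgebra.lift_of_apply] at this
          exact this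
      · by_cases hh : h ∈ ({g, g⁻¹} : Set G)
        · rcases t with (⟨⟨l, hl⟩, i, p⟩ | ⟨⟨i, p⟩, ⟨i', q⟩⟩) | t
          · by_cases hlh : l = h
            · subst hlh
              simp only [basisFamily]
              rw [← LieHom.map_lie, quotientHom_eq_zero.2
                (hI.lie_mem l hl _ _ (hmem l i p.1) (.var j l))]
              exact S.zero_mem
            · have hA : quotientHom I (yComm (x K i l) p.1) ∈ yCommSpan I (x K i l) :=
                Submodule.subset_span ⟨p, rfl⟩
              have hB := mem_yCommSpan_self I (x K j h)
              simp only [basisFamily]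
              rcases hl with rfl | hl <;> rcases hh with rfl | hh
              · exact absurd rfl hlh
              · rw [Set.mem_singleton_iff] at hh
                subst hh
                exact htwo i j _ hA _ hB
              · rw [Set.mem_singleton_iff] at hl
                subst hl
                rw [← lie_skew]
                exact S.neg_mem (htwo j i _ hB _ hA)
              · exact absurd (hl.trans hh.symm) hlh
          · simp only [basisFamily]
            rw [← LieHom.map_lie, quotientHom_eq_zero.2
              (hkill h hh _ _ _ (hmem g i p.1) (hmem g⁻¹ i' q.1) (.var j h))]
            exact S.zero_mem
          · simp only [basisFamily]
            rw [← lie_skew]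
            refine S.neg_mem (hone h hh j ?_)
            exact lie_mem_of_generators ((quotientHom I).comp (neutral K G)) _
              (fun k s hs => by
                rw [LieHom.comp_apply, neutral, FreeLieAlgebra.lift_of_apply]
                exact hI.lie_y_mem_yCommSpan hh (.var j h) k s hs) (b t) _
              (mem_yCommSpan_self I _)
        · rw [quotientHom_eq_zero.2 (hI.x_mem h h1 hh j), lie_zero]
          exact S.zero_mem
  induction u using freeLie_induction with
  | of z => exact hvar z
  | zero => simp
  | add a b ha hb => rw [map_add]; exact S.add_mem ha hb
  | smul c a ha => rw [map_smul]; exact S.smul_mem c ha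
  | lie a b ha hb =>
    rw [LieHom.map_lie]
    exact lie_mem_of_generators (quotientHom I) S hclosed b _ ha

end ContainsConsequences

end Spanning

/-! ### Upper triangular matrices -/

section Matrices

variable {K : Type*} [Field K]

/-- The upper triangular matrix with rows `(a, b, c)`, `(0, d, e)`, `(0, 0, f)`. -/
def ut3 (a b c d e f : K) : UT 3 K :=
  ⟨!![a, b, c; 0, d, e; 0, 0, f], by
    intro i j hij
    fin_cases i <;> fin_cases j <;> first | rfl | exact absurd hij (by decide)⟩

theorem eq_ut3 (A : UT 3 K) :
    A = ut3 (A.1 0 0) (A.1 0 1) (A.1 0 2) (A.1 1 1) (A.1 1 2) (A.1 2 2) := by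
  have h10 : A.1 1 0 = 0 := A.2 (by decide)
  have h20 : A.1 2 0 = 0 := A.2 (by decide)
  have h21 : A.1 2 1 = 0 := A.2 (by decide)
  apply Subtype.ext
  ext i j
  fin_cases i <;> fin_cases j <;> first | rfl | assumption

theorem ut3_zero : (ut3 0 0 0 0 0 0 : UT 3 K) = 0 := (eq_ut3 0).symm

theorem smul_ut3 (r a b c d e f : K) :
    r • ut3 a b c d e f = ut3 (r * a) (r * b) (r * c) (r * d) (r * e) (r * f) :=
  eq_ut3 (r • ut3 a b c d e f)

theorem add_ut3 (a b c d e f a' b' c' d' e' f' : K) :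
    ut3 a b c d e f + ut3 a' b' c' d' e' f' =
      ut3 (a + a') (b + b') (c + c') (d + d') (e + e') (f + f') :=
  eq_ut3 (ut3 a b c d e f + ut3 a' b' c' d' e' f')

theorem lie_ut3 (a b c d e f a' b' c' d' e' f' : K) :
    ⁅ut3 a b c d e f, ut3 a' b' c' d' e' f'⁆ =
      ut3 0 (a * b' + b * d' - (a' * b + b' * d))
        (a * c' + b * e' + c * f' - (a' * c + b' * e + c' * f))
        0 (d * e' + e * f' - (d' * e + e' * f)) 0 := by
  apply Subtype.ext
  rw [LieSubalgebra.coe_bracket, LieRing.of_associative_ring_bracket]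
  ext i j
  fin_cases i <;> fin_cases j <;>
    simp [ut3, mul_comm, add_assoc]

theorem ut2_lie (A B : UT 2 K) :
    ⁅A, B⁆.1 0 0 = 0 ∧ ⁅A, B⁆.1 1 1 = 0 ∧ ⁅A, B⁆.1 0 1 =
      A.1 0 0 * B.1 0 1 + A.1 0 1 * B.1 1 1 - (B.1 0 0 * A.1 0 1 + B.1 0 1 * A.1 1 1) := by
  have hA : A.1 1 0 = 0 := A.2 (by decide)
  have hB : B.1 1 0 = 0 := B.2 (by decide)
  rw [LieSubalgebra.coe_bracket, LieRing.of_associative_ring_bracket]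
  simp [Matrix.mul_apply, hA, hB, mul_comm]

/-- The upper triangular matrix with rows `(a, c)`, `(0, f)`. -/
def ut2 (a c f : K) : UT 2 K :=
  ⟨!![a, c; 0, f], by
    intro i j hij
    fin_cases i <;> fin_cases j <;> first | rfl | exact absurd hij (by decide)⟩

/-- `UT_2` sits in `UT_3` as the span of `e_11`, `e_13`, `e_33`. -/
def ut2Embedding (K : Type*) [Field K] : UT 2 K →ₗ⁅K⁆ UT 3 K where
  toFun A := ut3 (A.1 0 0) 0 (A.1 0 1) 0 0 (A.1 1 1)
  map_add' A B := by simp [add_ut3]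
  map_smul' r A := by simp [smul_ut3]
  map_lie' {A B} := by
    obtain ⟨h0, h1, h2⟩ := ut2_lie A B
    rw [lie_ut3, h0, h1, h2]
    simp

theorem ut2Embedding_injective : Function.Injective (ut2Embedding K) := by
  intro A B h
  have hA : A.1 1 0 = 0 := A.2 (by decide)
  have hB : B.1 1 0 = 0 := B.2 (by decide)
  have h' : (ut3 (A.1 0 0) 0 (A.1 0 1) 0 0 (A.1 1 1)).1 =
    (ut3 (B.1 0 0) 0 (B.1 0 1) 0 0 (B.1 1 1)).1 := congrArg Subtype.val h
  have h00 := congrFun (congrFun h' 0) 0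
  have h02 := congrFun (congrFun h' 0) 2
  have h22 := congrFun (congrFun h' 2) 2
  simp only [ut3] at h00 h02 h22
  apply Subtype.ext
  ext i j
  fin_cases i <;> fin_cases j
  · simpa using h00
  · simpa using h02
  · exact hA.trans hB.symm
  · simpa using h22

/-- The subalgebra spanned by `e_11`, `e_13`, `e_22`, `e_33` is the direct sum of a copy of `UT_2`
and the line of `e_22`, so the identities of `UT_2` hold in it. -/
theorem eval_eq_zero_of_ordinaryId {u : FreeLieAlgebra K ℕ} (hu : u ∈ ordinaryId K (UT 2 K))
    (φ : FreeLieAlgebra K ℕ →ₗ⁅K⁆ UT 3 K) (a c d f : ℕ → K)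
    (hφ : ∀ i, φ (FreeLieAlgebra.of K i) = ut3 (a i) 0 (c i) (d i) 0 (f i)) : φ u = 0 := by
  -- `φ₁` records the entries at `e_11`, `e_13`, `e_33`, and `φ₂` the entry at `e_22`.
  let φ₁ : FreeLieAlgebra K ℕ →ₗ⁅K⁆ UT 2 K :=
    FreeLieAlgebra.lift K fun i => ut2 (a i) (c i) (f i)
  let φ₂ : FreeLieAlgebra K ℕ →ₗ⁅K⁆ UT 2 K := FreeLieAlgebra.lift K fun i => ut2 (d i) 0 0
  have key : ∀ v, φ v =
      ut3 ((φ₁ v).1 0 0) 0 ((φ₁ v).1 0 1) ((φ₂ v).1 0 0) 0 ((φ₁ v).1 1 1) := by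
    intro v
    induction v using freeLie_induction with
    | of i =>
      rw [hφ]
      simp only [φ₁, φ₂, FreeLieAlgebra.lift_of_apply]
      simp [ut2]
    | zero => simp [ut3_zero]
    | add v w hv hw => rw [map_add, hv, hw, add_ut3]; simp
    | smul r v hv => rw [map_smul, hv, smul_ut3]; simp
    | lie v w hv hw =>
      obtain ⟨h0, h1, h2⟩ := ut2_lie (φ₁ v) (φ₁ w)
      obtain ⟨h3, -, -⟩ := ut2_lie (φ₂ v) (φ₂ w)
      rw [LieHom.map_lie, hv, hw, lie_ut3, LieHom.map_lie, LieHom.map_lie, h0, h1, h2, h3]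
      simp
  rw [key u, hu φ₁, hu φ₂]
  simp [ut3_zero]

end Matrices

/-! ### Graded identities of `UT_3` -/

section Gamma

variable {K G : Type*} [Field K] [CommGroup G] {g : G}

theorem ut3_mem_Gamma_one (a c d f : K) : ut3 a 0 c d 0 f ∈ Gamma K g g⁻¹ 1 := by
  intro i j hij
  fin_cases i <;> fin_cases j <;> simp [unitDegree, ut3] at hij ⊢

theorem ut3_mem_Gamma (b : K) : ut3 0 b 0 0 0 0 ∈ Gamma K g g⁻¹ g := by
  intro i j hij
  fin_cases i <;> fin_cases j <;> simp [unitDegree, ut3] at hij ⊢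

theorem ut3_mem_Gamma_inv (e : K) : ut3 0 0 0 0 e 0 ∈ Gamma K g g⁻¹ g⁻¹ := by
  intro i j hij
  fin_cases i <;> fin_cases j <;> simp [unitDegree, ut3] at hij ⊢

theorem ne_one_of_sq (hg : g ^ 2 ≠ 1) : g ≠ 1 := by
  rintro rfl
  simp at hg

theorem ne_inv_of_sq (hg : g ^ 2 ≠ 1) : g ≠ g⁻¹ := by
  intro h
  exact hg (by rw [sq]; exact mul_eq_one_iff_eq_inv.2 h)

theorem exists_of_mem_Gamma_one (hg : g ^ 2 ≠ 1) {A : UT 3 K} (hA : A ∈ Gamma K g g⁻¹ 1) :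
    ∃ a c d f, A = ut3 a 0 c d 0 f := by
  have h1 := ne_one_of_sq hg
  have h01 : A.1 0 1 = 0 := hA 0 1 (by simpa [unitDegree] using h1)
  have h12 : A.1 1 2 = 0 := hA 1 2 (by simpa [unitDegree] using h1)
  refine ⟨A.1 0 0, A.1 0 2, A.1 1 1, A.1 2 2, ?_⟩
  conv_lhs => rw [eq_ut3 A, h01, h12]

theorem exists_of_mem_Gamma (hg : g ^ 2 ≠ 1) {A : UT 3 K} (hA : A ∈ Gamma K g g⁻¹ g) :
    ∃ b, A = ut3 0 b 0 0 0 0 := by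
  have h1 := (ne_one_of_sq hg).symm
  have h2 := (ne_inv_of_sq hg).symm
  refine ⟨A.1 0 1, ?_⟩
  conv_lhs => rw [eq_ut3 A, hA 0 0 (by simpa [unitDegree] using h1),
    hA 0 2 (by simpa [unitDegree] using h1), hA 1 1 (by simpa [unitDegree] using h1),
    hA 1 2 (by simpa [unitDegree] using h2), hA 2 2 (by simpa [unitDegree] using h1)]

theorem exists_of_mem_Gamma_inv (hg : g ^ 2 ≠ 1) {A : UT 3 K} (hA : A ∈ Gamma K g g⁻¹ g⁻¹) :
    ∃ e, A = ut3 0 0 0 0 e 0 := by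
  have h1 : 1 ≠ g⁻¹ := by simpa [eq_comm] using ne_one_of_sq hg
  have h2 := ne_inv_of_sq hg
  refine ⟨A.1 1 2, ?_⟩
  conv_lhs => rw [eq_ut3 A, hA 0 0 (by simpa [unitDegree] using h1),
    hA 0 2 (by simpa [unitDegree] using h1), hA 1 1 (by simpa [unitDegree] using h1),
    hA 0 1 (by simpa [unitDegree] using h2), hA 2 2 (by simpa [unitDegree] using h1)]

theorem Gamma_eq_bot {l : G} (h1 : l ≠ 1) (hl : l ∉ ({g, g⁻¹} : Set G)) :
    Gamma K g g⁻¹ l = ⊥ := by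
  simp only [Set.mem_insert_iff, Set.mem_singleton_iff, not_or] at hl
  obtain ⟨h2, h3⟩ := hl
  rw [Submodule.eq_bot_iff]
  intro A hA
  rw [eq_ut3 A, hA 0 0 (by simpa [unitDegree] using h1.symm),
    hA 0 1 (by simpa [unitDegree] using Ne.symm h2),
    hA 0 2 (by simpa [unitDegree] using h1.symm), hA 1 1 (by simpa [unitDegree] using h1.symm),
    hA 1 2 (by simpa [unitDegree] using Ne.symm h3),
    hA 2 2 (by simpa [unitDegree] using h1.symm), ut3_zero]

theorem notMem_support_iff (l : G) :
    l ∉ support (Gamma K g g⁻¹) ↔ l ≠ 1 ∧ l ∉ ({g, g⁻¹} : Set G) := by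
  have hne : ∀ {h : G} {A : UT 3 K}, A ∈ Gamma K g g⁻¹ h → A ≠ 0 →
      h ∈ support (Gamma K g g⁻¹) := by
    intro h A hA hA0 hbot
    rw [hbot] at hA
    exact hA0 ((Submodule.mem_bot K).1 hA)
  refine ⟨fun h => ⟨?_, ?_⟩, fun h => not_not.2 (Gamma_eq_bot h.1 h.2)⟩
  · rintro rfl
    refine h (hne (ut3_mem_Gamma_one (1 : K) 0 0 0) fun h0 => ?_)
    simpa [ut3] using congrArg (fun A : UT 3 K => A.1 0 0) h0
  · rintro (rfl | rfl)
    · refine h (hne (ut3_mem_Gamma (1 : K)) fun h0 => ?_)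
      simpa [ut3] using congrArg (fun A : UT 3 K => A.1 0 1) h0
    · refine h (hne (ut3_mem_Gamma_inv (1 : K)) fun h0 => ?_)
      simpa [ut3] using congrArg (fun A : UT 3 K => A.1 1 2) h0

theorem unitDegree_mul_unitDegree (g h : G) (i j k : Fin 3) :
    unitDegree g h i k * unitDegree g h k j = unitDegree g h i j := by
  simp [unitDegree]

theorem mul_apply_eq_zero_of_mem_Gamma {h k : G} {A B : UT 3 K} (hA : A ∈ Gamma K g g⁻¹ h)
    (hB : B ∈ Gamma K g g⁻¹ k) {i j : Fin 3} (hij : unitDegree g g⁻¹ i j ≠ h * k) :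
    (A.1 * B.1) i j = 0 := by
  rw [Matrix.mul_apply]
  refine Finset.sum_eq_zero fun m _ => ?_
  by_cases h1 : unitDegree g g⁻¹ i m = h
  · by_cases h2 : unitDegree g g⁻¹ m j = k
    · exact absurd (by rw [← h1, ← h2, unitDegree_mul_unitDegree]) hij
    · rw [hB m j h2, mul_zero]
  · rw [hA i m h1, zero_mul]

theorem lie_mem_Gamma {h k : G} {A B : UT 3 K} (hA : A ∈ Gamma K g g⁻¹ h)
    (hB : B ∈ Gamma K g g⁻¹ k) : ⁅A, B⁆ ∈ Gamma K g g⁻¹ (h * k) := by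
  intro i j hij
  rw [LieSubalgebra.coe_bracket, LieRing.of_associative_ring_bracket, Matrix.sub_apply,
    mul_apply_eq_zero_of_mem_Gamma hA hB hij,
    mul_apply_eq_zero_of_mem_Gamma hB hA (by rwa [mul_comm]), sub_zero]

theorem IsGradedHom.map_mem {φ : FreeGraded K G →ₗ⁅K⁆ UT 3 K}
    (hφ : IsGradedHom (Gamma K g g⁻¹) φ) {h : G} {a : FreeGraded K G} (ha : IsHomogeneous h a) :
    φ a ∈ Gamma K g g⁻¹ h := by
  induction ha with
  | var i h => exact hφ i h
  | zero h => rw [map_zero]; exact Submodule.zero_mem _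
  | add _ _ iha ihb => rw [map_add]; exact Submodule.add_mem _ iha ihb
  | smul c _ iha => rw [map_smul]; exact Submodule.smul_mem _ c iha
  | lie _ _ iha ihb => rw [LieHom.map_lie]; exact lie_mem_Gamma iha ihb

/-- A graded endomorphism followed by a graded evaluation is again a graded evaluation. -/
theorem isTIdeal_gradedId : IsTIdeal (gradedId (Gamma K g g⁻¹)) := fun φ hφ _ hf ψ hψ =>
  hf (ψ.comp φ) fun i h => hψ.map_mem (hφ i h)

theorem lieIter_ut3_left (b a c d f : K) (m : ℕ) :
    lieIter (ut3 0 b 0 0 0 0) (ut3 a 0 c d 0 f) m = ut3 0 ((d - a) ^ m * b) 0 0 0 0 := by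
  induction m with
  | zero => simp [lieIter]
  | succ m ih =>
    rw [lieIter_succ, ih, lie_ut3]
    congr 1 <;> ring

theorem lieIter_ut3_right (e a c d f : K) (m : ℕ) :
    lieIter (ut3 0 0 0 0 e 0) (ut3 a 0 c d 0 f) m = ut3 0 0 0 0 ((f - d) ^ m * e) 0 := by
  induction m with
  | zero => simp [lieIter]
  | succ m ih =>
    rw [lieIter_succ, ih, lie_ut3]
    congr 1 <;> ring

theorem exists_of_mem_Gamma_pair (hg : g ^ 2 ≠ 1) {l : G} (hl : l ∈ ({g, g⁻¹} : Set G))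
    {A : UT 3 K} (hA : A ∈ Gamma K g g⁻¹ l) :
    (∃ b, A = ut3 0 b 0 0 0 0) ∨ ∃ e, A = ut3 0 0 0 0 e 0 := by
  rcases hl with rfl | hl
  · exact .inl (exists_of_mem_Gamma hg hA)
  · rw [Set.mem_singleton_iff] at hl
    subst hl
    exact .inr (exists_of_mem_Gamma_inv hg hA)

theorem generators_subset_gradedId (hg : g ^ 2 ≠ 1) :
    generators K g ⊆ (gradedId (Gamma K g g⁻¹) : Set (FreeGraded K G)) := by
  rintro f ((((⟨l, hl, rfl⟩ | ⟨l, hl, rfl⟩) | ⟨l, hl, h, hh, hlh, rfl⟩) | ⟨l, hl, rfl⟩) |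
    ⟨u, hu, rfl⟩) <;> intro φ hφ
  · have := hφ 1 l
    rwa [not_not.1 hl, Submodule.mem_bot] at this
  · rcases hl with rfl | rfl
    · obtain ⟨b, h1⟩ := exists_of_mem_Gamma hg (hφ 1 l)
      obtain ⟨c, h2⟩ := exists_of_mem_Gamma hg (hφ 2 l)
      simp [h1, h2, lie_ut3, ut3_zero]
    · obtain ⟨b, h1⟩ := exists_of_mem_Gamma_inv hg (hφ 1 g⁻¹)
      obtain ⟨c, h2⟩ := exists_of_mem_Gamma_inv hg (hφ 2 g⁻¹)
      simp [h1, h2, lie_ut3, ut3_zero]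
  · obtain ⟨b, h1⟩ | ⟨b, h1⟩ := exists_of_mem_Gamma_pair hg hl (hφ 1 l) <;>
    obtain ⟨c, h2⟩ | ⟨c, h2⟩ := exists_of_mem_Gamma_pair hg hh (hφ 1 h) <;>
    obtain ⟨d, h3⟩ | ⟨d, h3⟩ := exists_of_mem_Gamma_pair hg hl (hφ 2 l) <;>
    simp [h1, h2, h3, lie_ut3, ut3_zero]
  · obtain ⟨a, c, d, f, h1⟩ := exists_of_mem_Gamma_one hg (hφ 1 1)
    obtain ⟨a', c', d', f', h2⟩ := exists_of_mem_Gamma_one hg (hφ 2 1)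
    obtain ⟨b, h3⟩ | ⟨b, h3⟩ := exists_of_mem_Gamma_pair hg hl (hφ 1 l) <;>
    · rw [LieHom.map_lie, LieHom.map_lie, y, y, h1, h2, h3, lie_ut3, lie_ut3]
      simp [ut3_zero, mul_comm]
  · choose a c d f h using fun i => exists_of_mem_Gamma_one hg (hφ i 1)
    refine eval_eq_zero_of_ordinaryId hu (φ.comp (neutral K G)) a c d f fun i => ?_
    rw [LieHom.comp_apply, neutral, FreeLieAlgebra.lift_of_apply]
    exact h i

theorem finiteGenerators_subset_gradedId [Finite K] (hg : g ^ 2 ≠ 1) :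
    finiteGenerators K g (Nat.card K) ⊆ (gradedId (Gamma K g g⁻¹) : Set (FreeGraded K G)) := by
  rintro f ⟨l, hl, rfl⟩ φ hφ
  cases nonempty_fintype K
  obtain ⟨a, c, d, f, hy⟩ := exists_of_mem_Gamma_one hg (hφ 1 1)
  have hpow : ∀ r : K, r ^ Nat.card K = r := fun r => by
    rw [Nat.card_eq_fintype_card, FiniteField.pow_card]
  rw [map_sub, map_lieIter, LieHom.map_lie]
  change lieIter _ (φ (x K 1 1)) _ - ⁅_, φ (x K 1 1)⁆ = 0
  rw [hy, sub_eq_zero]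
  change _ = lieIter (φ (x K 1 l)) _ 1
  obtain ⟨b, h1⟩ | ⟨b, h1⟩ := exists_of_mem_Gamma_pair hg hl (hφ 1 l)
  · rw [h1, lieIter_ut3_left, lieIter_ut3_left, hpow, pow_one]
  · rw [h1, lieIter_ut3_right, lieIter_ut3_right, hpow, pow_one]

end Gamma

/-! ### Monomial functions -/

section Independence

variable {K : Type*} [Field K]

theorem exists_finset_lt_card {K : Type*} {d : ℕ} (hd : (d : ℕ∞) < ENat.card K) :
    ∃ S : Finset K, d < S.card := by
  rcases finite_or_infinite K with hK | hK
  · cases nonempty_fintype K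
    refine ⟨Finset.univ, ?_⟩
    rw [ENat.card_eq_coe_fintype_card] at hd
    exact_mod_cast hd
  · obtain ⟨S, hS⟩ := Infinite.exists_subset_card_eq K (d + 1)
    exact ⟨S, by omega⟩

/-- A polynomial in any number of variables whose degree in each variable is less than `|K|`
vanishes as soon as it vanishes as a function. -/
theorem mvPolynomial_eq_zero {σ : Type*} (P : MvPolynomial σ K)
    (hdeg : ∀ i, (P.degreeOf i : ℕ∞) < ENat.card K) (h : ∀ v, MvPolynomial.eval v P = 0) :
    P = 0 := by
  obtain ⟨s, P, rfl⟩ := MvPolynomial.exists_finset_rename P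
  have hinj : Function.Injective ((↑) : s → σ) := Subtype.val_injective
  have hdeg' : ∀ i : s, (P.degreeOf i : ℕ∞) < ENat.card K := fun i => by
    simpa [MvPolynomial.degreeOf_rename_of_injective hinj] using hdeg i
  choose S hS using fun i : s => exists_finset_lt_card (hdeg' i)
  rw [MvPolynomial.eq_zero_of_eval_zero_at_prod_finset P S hS fun v _ => ?_, map_zero]
  have := h (Function.extend (↑) v 0)
  rwa [MvPolynomial.eval_rename, Function.extend_comp hinj] at this

/-- The monomial function `v ↦ ∏ v_i^{p_i}`. -/
noncomputable def monomialFun {σ : Type*} (p : σ →₀ ℕ) (v : σ → K) : K := p.prod fun i n => v i ^ n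

theorem linearIndependent_of_forall_eq {V ι : Type*} [AddCommGroup V] [Module K V] {v w : ι → V}
    (hw : LinearIndependent K w) (h : ∀ i, v i = w i) : LinearIndependent K v :=
  funext h ▸ hw

theorem linearIndependent_monomialFun (σ : Type*) :
    LinearIndependent K fun p : {p : σ →₀ ℕ // ∀ i, (p i : ℕ∞) < ENat.card K} =>
      (monomialFun p.1 : (σ → K) → K) := by
  classical
  rw [linearIndependent_iff']
  intro s c hc p hp
  have hz : ∑ q ∈ s, MvPolynomial.monomial q.1 (c q) = 0 := by
    refine mvPolynomial_eq_zero _ (fun i => ?_) fun v => ?_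
    · refine lt_of_le_of_lt (b := ((s.sup fun q => q.1 i : ℕ) : ℕ∞)) ?_ ?_
      · norm_cast
        refine (MvPolynomial.degreeOf_sum_le i s _).trans ?_
        refine Finset.sup_mono_fun fun q _ => ?_
        by_cases hq : c q = 0
        · simp [hq]
        · rw [MvPolynomial.degreeOf_monomial_eq _ _ hq]
      · rcases s.eq_empty_or_nonempty with rfl | hs
        · simp
        · obtain ⟨q, -, hq⟩ := Finset.exists_mem_eq_sup s hs fun q => q.1 i
          rw [hq]
          exact q.2 i
    · have := congrFun hc v
      rw [Finset.sum_apply] at this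
      simpa [MvPolynomial.eval_monomial, monomialFun] using this
  have := congrArg (MvPolynomial.coeff p.1) hz
  rw [MvPolynomial.coeff_sum] at this
  simp only [MvPolynomial.coeff_monomial, MvPolynomial.coeff_zero] at this
  rw [Finset.sum_eq_single p (fun q _ hqp => if_neg fun h => hqp (Subtype.ext h))
    (fun h => absurd hp h), if_pos rfl] at this
  exact this

theorem linearIndependent_monomialFun_mul :
    LinearIndependent K fun pq : Exponents K × Exponents K =>
      fun v : (ℕ → K) × (ℕ → K) => monomialFun pq.1.1 v.1 * monomialFun pq.2.1 v.2 := by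
  let e : Exponents K × Exponents K →
      {p : ℕ ⊕ ℕ →₀ ℕ // ∀ i, (p i : ℕ∞) < ENat.card K} := fun pq =>
    ⟨Finsupp.sumElim pq.1.1 pq.2.1, by
      rintro (i | i)
      · simpa using pq.1.2 i
      · simpa using pq.2.2 i⟩
  have he : Function.Injective e := by
    rintro ⟨p, q⟩ ⟨p', q'⟩ h
    have h' := congrArg Subtype.val h
    refine Prod.ext (Subtype.ext (Finsupp.ext fun i => ?_)) (Subtype.ext (Finsupp.ext fun i => ?_))
    · simpa [e] using DFunLike.congr_fun h' (.inl i)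
    · simpa [e] using DFunLike.congr_fun h' (.inr i)
  have h := (linearIndependent_monomialFun (K := K) (ℕ ⊕ ℕ)).comp e he
  have h2 := h.map' (LinearMap.funLeft K K fun v : (ℕ → K) × (ℕ → K) => Sum.elim v.1 v.2)
    (LinearMap.ker_eq_bot.2 (LinearMap.funLeft_injective_of_surjective K K _ fun v =>
      ⟨(fun i => v (.inl i), fun i => v (.inr i)), by ext (i | i) <;> rfl⟩))
  refine linearIndependent_of_forall_eq h2 fun pq => funext fun v => ?_
  simp [e, monomialFun, LinearMap.funLeft, Finsupp.prod_sumElim, Function.comp_def]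

/-- A linear map which kills `W` and all members of a family outside a block, and under which the
block becomes independent, shows that the coefficients of the block vanish in each relation
modulo `W`. -/
theorem coeff_eq_zero_of_block {V V' ι κ : Type*} [AddCommGroup V] [Module K V] [AddCommGroup V']
    [Module K V'] {W : Submodule K V} {v : ι → V} {e : κ → ι} (he : Function.Injective e)
    (F : V →ₗ[K] V') (hW : ∀ w ∈ W, F w = 0) (hv : ∀ i ∉ Set.range e, F (v i) = 0)
    (hF : LinearIndependent K fun k => F (v (e k))) {s : Finset ι} {c : ι → K}
    (hc : ∑ i ∈ s, c i • v i ∈ W) {k : κ} (hk : e k ∈ s) : c (e k) = 0 := by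
  classical
  have h := hW _ hc
  rw [map_sum, ← Finset.sum_preimage e s he.injOn] at h
  · simp only [map_smul] at h
    exact linearIndependent_iff'.1 hF _ (fun k => c (e k)) h k (by simpa using hk)
  · intro i _ hi
    rw [map_smul, hv i hi, smul_zero]

end Independence

/-! ### Linear independence -/

section Evaluation

variable {K G : Type*} [Field K] [CommGroup G] {g : G}

open Classical in
/-- The graded evaluation at diagonal `y_i` with `x_{i,g} ↦ a_i e_12`, `x_{i,g⁻¹} ↦ b_i e_23` and
`y_i ↦ t_i e_33 - s_i e_11`, so that `[·, y_i]` acts on `e_12` as `s_i` and on `e_23` as `t_i`. -/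
noncomputable def evalHom (g : G) (a b s t : ℕ → K) : FreeGraded K G →ₗ⁅K⁆ UT 3 K :=
  FreeLieAlgebra.lift K fun z =>
    if z.2 = 1 then ut3 (-s z.1) 0 0 0 0 (t z.1) else if z.2 = g then ut3 0 (a z.1) 0 0 0 0
    else if z.2 = g⁻¹ then ut3 0 0 0 0 (b z.1) 0 else 0

variable (a b s t : ℕ → K)

theorem evalHom_y (i : ℕ) : evalHom g a b s t (y K G i) = ut3 (-s i) 0 0 0 0 (t i) := by
  rw [y, x, evalHom, FreeLieAlgebra.lift_of_apply, if_pos rfl]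

theorem evalHom_x (hg : g ^ 2 ≠ 1) (i : ℕ) : evalHom g a b s t (x K i g) = ut3 0 (a i) 0 0 0 0 := by
  rw [x, evalHom, FreeLieAlgebra.lift_of_apply, if_neg (ne_one_of_sq hg), if_pos rfl]

theorem evalHom_x_inv (hg : g ^ 2 ≠ 1) (i : ℕ) :
    evalHom g a b s t (x K i g⁻¹) = ut3 0 0 0 0 (b i) 0 := by
  rw [x, evalHom, FreeLieAlgebra.lift_of_apply, if_neg (by simpa using ne_one_of_sq hg),
    if_neg (ne_inv_of_sq hg).symm, if_pos rfl]

theorem isGradedHom_evalHom : IsGradedHom (Gamma K g g⁻¹) (evalHom g a b s t) := by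
  intro i h
  rw [x, evalHom, FreeLieAlgebra.lift_of_apply]
  dsimp only
  split_ifs with h1 h2 h3
  · subst h1; exact ut3_mem_Gamma_one _ _ _ _
  · subst h2; exact ut3_mem_Gamma _
  · subst h3; exact ut3_mem_Gamma_inv _
  · exact Submodule.zero_mem _

theorem prod_range_pow (p : ℕ →₀ ℕ) {n : ℕ} (hn : p.support ⊆ Finset.range n) (v : ℕ → K) :
    ∏ k ∈ Finset.range n, v k ^ p k = monomialFun p v :=
  (Finsupp.prod_of_support_subset p hn _ fun _ _ => pow_zero _).symm

theorem evalHom_yComm (hg : g ^ 2 ≠ 1) (i : ℕ) (p : ℕ →₀ ℕ) :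
    evalHom g a b s t (yComm (x K i g) p) = ut3 0 (monomialFun p s * a i) 0 0 0 0 := by
  obtain ⟨n, -, hn⟩ := exists_support_subset_range p 0
  rw [yComm_eq_iterLie _ p hn, map_iterLie, evalHom_x _ _ _ _ hg, ← prod_range_pow p hn]
  clear hn
  induction n with
  | zero => simp [iterLie]
  | succ n ih =>
    rw [iterLie, ih, evalHom_y, lieIter_ut3_left, Finset.prod_range_succ]
    congr 1
    ring

theorem evalHom_yComm_inv (hg : g ^ 2 ≠ 1) (i : ℕ) (p : ℕ →₀ ℕ) :
    evalHom g a b s t (yComm (x K i g⁻¹) p) = ut3 0 0 0 0 (monomialFun p t * b i) 0 := by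
  obtain ⟨n, -, hn⟩ := exists_support_subset_range p 0
  rw [yComm_eq_iterLie _ p hn, map_iterLie, evalHom_x_inv _ _ _ _ hg, ← prod_range_pow p hn]
  clear hn
  induction n with
  | zero => simp [iterLie]
  | succ n ih =>
    rw [iterLie, ih, evalHom_y, lieIter_ut3_right, Finset.prod_range_succ]
    congr 1
    ring

theorem evalHom_lie_yComm (hg : g ^ 2 ≠ 1) (i j : ℕ) (p q : ℕ →₀ ℕ) :
    evalHom g a b s t ⁅yComm (x K i g) p, yComm (x K j g⁻¹) q⁆ =
      ut3 0 0 (monomialFun p s * a i * (monomialFun q t * b j)) 0 0 0 := by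
  rw [LieHom.map_lie, evalHom_yComm _ _ _ _ hg, evalHom_yComm_inv _ _ _ _ hg, lie_ut3]
  simp

theorem evalHom_neutral (u : FreeLieAlgebra K ℕ) :
    ∃ r r', evalHom g a b s t (neutral K G u) = ut3 r 0 0 0 0 r' := by
  induction u using freeLie_induction with
  | of i =>
    rw [neutral, FreeLieAlgebra.lift_of_apply, evalHom_y]
    exact ⟨_, _, rfl⟩
  | zero => exact ⟨0, 0, by simp [ut3_zero]⟩
  | add u v hu hv =>
    obtain ⟨r, r', h⟩ := hu
    obtain ⟨q, q', h'⟩ := hv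
    exact ⟨r + q, r' + q', by simp [h, h', add_ut3]⟩
  | smul c u hu =>
    obtain ⟨r, r', h⟩ := hu
    exact ⟨c * r, c * r', by simp [h, smul_ut3]⟩
  | lie u v hu hv =>
    obtain ⟨r, r', h⟩ := hu
    obtain ⟨q, q', h'⟩ := hv
    exact ⟨0, 0, by simp [h, h', lie_ut3, mul_comm]⟩

/-- The `(k, l)` entry of a family of evaluations of a polynomial, as a function of the
parameters. -/
noncomputable def entryMap {T : Type*} (g : G) (a b : ℕ → K) (s t : T → ℕ → K) (k l : Fin 3) :
    FreeGraded K G →ₗ[K] (T → K) where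
  toFun f v := (evalHom g a b (s v) (t v) f).1 k l
  map_add' f f' := by ext v; simp
  map_smul' c f := by ext v; simp

theorem entryMap_eq_zero {T : Type*} (s t : T → ℕ → K) (k l : Fin 3) {f : FreeGraded K G}
    (hf : f ∈ (gradedId (Gamma K g g⁻¹)).toSubmodule) : entryMap g a b s t k l f = 0 := by
  ext v
  have : evalHom g a b (s v) (t v) f = 0 := hf _ (isGradedHom_evalHom _ _ _ _)
  simp [entryMap, this]

open Classical in
/-- The retraction of `L(X^G)` onto `L(Y)` which kills the variables of degree different from `1`. -/
noncomputable def neutralPart (K G : Type*) [Field K] [CommGroup G] :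
    FreeGraded K G →ₗ⁅K⁆ FreeLieAlgebra K ℕ :=
  FreeLieAlgebra.lift K fun z => if z.2 = 1 then FreeLieAlgebra.of K z.1 else 0

theorem neutralPart_neutral (u : FreeLieAlgebra K ℕ) : neutralPart K G (neutral K G u) = u := by
  have : (neutralPart K G).comp (neutral K G) = LieHom.id := by
    ext i
    simp [neutralPart, neutral, y, x]
  exact LieHom.congr_fun this u

theorem neutralPart_yComm {l : G} (hl : l ≠ 1) (i : ℕ) (p : ℕ →₀ ℕ) :
    neutralPart K G (yComm (x K i l) p) = 0 := by
  obtain ⟨n, -, hn⟩ := exists_support_subset_range p 0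
  have hx : neutralPart K G (x K i l) = 0 := by
    rw [x, neutralPart, FreeLieAlgebra.lift_of_apply, if_neg hl]
  rw [yComm_eq_iterLie _ p hn, map_iterLie, hx]
  exact iterLie_mem (N := {0}) (by simp) (by simp) p n

theorem neutralPart_mem {f : FreeGraded K G} (hf : f ∈ gradedId (Gamma K g g⁻¹)) :
    neutralPart K G f ∈ ordinaryId K (UT 2 K) := by
  intro φ
  refine ut2Embedding_injective ?_
  rw [map_zero]
  refine hf ((ut2Embedding K).comp (φ.comp (neutralPart K G))) fun i h => ?_
  rw [LieHom.comp_apply, LieHom.comp_apply, x, neutralPart, FreeLieAlgebra.lift_of_apply]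
  dsimp only
  split_ifs with h1
  · subst h1
    exact ut3_mem_Gamma_one _ _ _ _
  · rw [map_zero, map_zero]
    exact Submodule.zero_mem _

/-- Each of the four kinds of polynomials is detected by its own linear map: the neutral part for
polynomials in the `y_i`, and the entries `e_12`, `e_23`, `e_13` of the evaluations at diagonal
`y_i` for the others, where the values are multiples of distinct monomial functions. -/
theorem linearIndependent_basisFamily (hg : g ^ 2 ≠ 1) {ι : Type*} {β : ι → FreeLieAlgebra K ℕ}
    (hβ : LinearIndependent K fun t => (ordinaryId K (UT 2 K)).toSubmodule.mkQ (β t)) :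
    LinearIndependent K fun t =>
      (gradedId (Gamma K g g⁻¹)).toSubmodule.mkQ (basisFamily K g β t) := by
  classical
  have hgi := ne_inv_of_sq hg
  have hg1 := ne_one_of_sq hg
  have hg1' : g⁻¹ ≠ 1 := by simpa using hg1
  rw [linearIndependent_iff']
  intro S c hc z hz
  have hc' : ∑ i ∈ S, c i • basisFamily K g β i ∈ (gradedId (Gamma K g g⁻¹)).toSubmodule := by
    rw [← Submodule.Quotient.mk_eq_zero, ← Submodule.mkQ_apply, map_sum]
    simpa only [map_smul] using hc
  have hmon := linearIndependent_monomialFun (K := K) ℕ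
  rcases z with (⟨⟨l, hl⟩, i, p⟩ | ⟨⟨i, p⟩, ⟨j, q⟩⟩) | τ
  · have hl' := hl
    rcases hl' with h | h
    · subst h
      refine coeff_eq_zero_of_block (e := fun p : Exponents K => .inl (.inl (⟨l, hl⟩, i, p)))
        (fun p q h => by simpa using h)
        (entryMap l (Pi.single i 1) 0 (fun s : ℕ → K => s) 0 0 1)
        (fun f hf => entryMap_eq_zero _ _ _ _ _ _ hf) ?_ ?_ hc' hz
      · rintro ((⟨⟨l', hl'⟩, i', p'⟩ | ⟨⟨i', p'⟩, ⟨j', q'⟩⟩) | τ) hne <;> ext s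
        · rcases hl' with h | h
          · subst h
            have hi : i' ≠ i := by rintro rfl; exact hne ⟨p', rfl⟩
            simp [entryMap, basisFamily, evalHom_yComm _ _ _ _ hg, ut3, hi]
          · rw [Set.mem_singleton_iff] at h
            subst h
            simp [entryMap, basisFamily, evalHom_yComm_inv _ _ _ _ hg, ut3]
        · simp [entryMap, basisFamily, evalHom_lie_yComm _ _ _ _ hg, ut3, -LieHom.map_lie]
        · obtain ⟨r, r', h⟩ := evalHom_neutral (g := l) (Pi.single i 1) 0 s 0 (β τ)
          simp [entryMap, basisFamily, h, ut3]
      · refine linearIndependent_of_forall_eq hmon fun p => funext fun s => ?_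
        simp [entryMap, basisFamily, evalHom_yComm _ _ _ _ hg, ut3]
    · rw [Set.mem_singleton_iff] at h
      subst h
      refine coeff_eq_zero_of_block (e := fun p : Exponents K => .inl (.inl (⟨g⁻¹, hl⟩, i, p)))
        (fun p q h => by simpa using h)
        (entryMap g 0 (Pi.single i 1) 0 (fun t : ℕ → K => t) 1 2)
        (fun f hf => entryMap_eq_zero _ _ _ _ _ _ hf) ?_ ?_ hc' hz
      · rintro ((⟨⟨l', hl'⟩, i', p'⟩ | ⟨⟨i', p'⟩, ⟨j', q'⟩⟩) | τ) hne <;> ext s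
        · rcases hl' with h | h
          · subst h
            simp [entryMap, basisFamily, evalHom_yComm _ _ _ _ hg, ut3]
          · rw [Set.mem_singleton_iff] at h
            subst h
            have hi : i' ≠ i := by rintro rfl; exact hne ⟨p', rfl⟩
            simp [entryMap, basisFamily, evalHom_yComm_inv _ _ _ _ hg, ut3, hi]
        · simp [entryMap, basisFamily, evalHom_lie_yComm _ _ _ _ hg, ut3, -LieHom.map_lie]
        · obtain ⟨r, r', h⟩ := evalHom_neutral (g := g) 0 (Pi.single i 1) 0 s (β τ)
          simp [entryMap, basisFamily, h, ut3]
      · refine linearIndependent_of_forall_eq hmon fun p => funext fun s => ?_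
        simp [entryMap, basisFamily, evalHom_yComm_inv _ _ _ _ hg, ut3]
  · refine coeff_eq_zero_of_block
      (e := fun pq : Exponents K × Exponents K => .inl (.inr ((i, pq.1), (j, pq.2))))
      (k := (p, q)) (fun p q h => by simpa [Prod.ext_iff] using h)
      (entryMap g (Pi.single i 1) (Pi.single j 1)
        (fun v : (ℕ → K) × (ℕ → K) => v.1) (fun v => v.2) 0 2)
      (fun f hf => entryMap_eq_zero _ _ _ _ _ _ hf) ?_ ?_ hc' hz
    · rintro ((⟨⟨l', hl'⟩, i', p'⟩ | ⟨⟨i', p'⟩, ⟨j', q'⟩⟩) | τ) hne <;> ext v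
      · rcases hl' with h | h
        · subst h
          simp [entryMap, basisFamily, evalHom_yComm _ _ _ _ hg, ut3]
        · rw [Set.mem_singleton_iff] at h
          subst h
          simp [entryMap, basisFamily, evalHom_yComm_inv _ _ _ _ hg, ut3]
      · have hij : i' ≠ i ∨ j' ≠ j := by
          by_contra! h
          obtain ⟨rfl, rfl⟩ := h
          exact hne ⟨(p', q'), rfl⟩
        rcases hij with h | h <;>
        simp [entryMap, basisFamily, evalHom_lie_yComm _ _ _ _ hg, ut3, h, -LieHom.map_lie]
      · obtain ⟨r, r', h⟩ :=
          evalHom_neutral (g := g) (Pi.single i 1) (Pi.single j 1) v.1 v.2 (β τ)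
        simp [entryMap, basisFamily, h, ut3]
    · refine linearIndependent_of_forall_eq linearIndependent_monomialFun_mul fun pq => funext fun v => ?_
      simp [entryMap, basisFamily, evalHom_lie_yComm _ _ _ _ hg, ut3, -LieHom.map_lie]
  · refine coeff_eq_zero_of_block (e := Sum.inr) Sum.inr_injective
      ((ordinaryId K (UT 2 K)).toSubmodule.mkQ ∘ₗ (neutralPart K G : FreeGraded K G →ₗ[K] _))
      (fun f hf => ?_) ?_ ?_ hc' hz
    · exact (Submodule.Quotient.mk_eq_zero _).2 (neutralPart_mem hf)
    · rintro ((⟨⟨l', hl'⟩, i', p'⟩ | ⟨⟨i', p'⟩, ⟨j', q'⟩⟩) | τ) hne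
      · have hl1 : l' ≠ 1 := by rcases hl' with rfl | rfl <;> assumption
        simp [basisFamily, neutralPart_yComm hl1]
      · simp [basisFamily, neutralPart_yComm hg1]
      · exact absurd ⟨τ, rfl⟩ hne
    · simpa [basisFamily, neutralPart_neutral] using hβ

end Evaluation

/-! ### The identities and the basis -/

section Conclusion

variable {K G : Type*} [Field K] [CommGroup G] {g : G}

/-- Each consequence is the image of a generator under a graded endomorphism that changes at most
three variables; these are distinct because `1`, `l` and `h` are. -/
theorem containsConsequences_tIdealSpan (hg : g ^ 2 ≠ 1) {S : Set (FreeGraded K G)} (hS : generators K g ⊆ S)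
    (hfin : Finite K → finiteGenerators K g (Nat.card K) ⊆ S) :
    ContainsConsequences g (tIdealSpan S) := by
  classical
  have hl1 : ∀ l ∈ ({g, g⁻¹} : Set G), l ≠ 1 := by
    rintro l (rfl | rfl)
    · exact ne_one_of_sq hg
    · exact inv_ne_one.2 (ne_one_of_sq hg)
  refine ⟨fun l h1 hl i => ?_, fun l hl a b ha hb => ?_, fun l hl h hh hlh a b c ha hb hc => ?_,
    fun l hl i j a ha => ?_, fun u hu => ?_, fun hK l hl k a ha => ?_⟩
  · have := lift_mem_tIdealSpan (isGradedSubst_of.update 1 (.var i l))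
      (hS (.inl (.inl (.inl (.inl ⟨l, (notMem_support_iff l).2 ⟨h1, hl⟩, rfl⟩)))))
    simpa [x] using this
  · have := lift_mem_tIdealSpan ((isGradedSubst_of.update 1 ha).update 2 hb)
      (hS (.inl (.inl (.inl (.inr ⟨l, hl, rfl⟩)))))
    simpa [x, Function.update_apply] using this
  · have := lift_mem_tIdealSpan (((isGradedSubst_of.update 1 ha).update 1 hb).update 2 hc)
      (hS (.inl (.inl (.inr ⟨l, hl, h, hh, hlh, rfl⟩))))
    simpa [x, Function.update_apply, hlh, -lie_lie] using this
  · have h1 := hl1 l hl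
    have := lift_mem_tIdealSpan
      (((isGradedSubst_of.update 1 (.var i 1)).update 2 (.var j 1)).update 1 ha)
      (hS (.inl (.inr ⟨l, hl, rfl⟩)))
    simpa [x, y, Function.update_apply, h1, Ne.symm h1, -lie_lie] using this
  · exact subset_tIdealSpan (hS (.inr ⟨u, hu, rfl⟩))
  · have h1 := hl1 l hl
    have := lift_mem_tIdealSpan ((isGradedSubst_of.update 1 (.var k 1)).update 1 ha)
      (hfin hK ⟨l, hl, rfl⟩)
    simpa [x, y, map_lieIter, Function.update_apply, h1, Ne.symm h1] using this

/-- Modulo an ideal `I` of identities that contains the consequences, an identity is a combination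
of the family `basisFamily`. The combination is itself an identity, so its coefficients vanish. -/
theorem gradedId_eq_of_containsConsequences (hg : g ^ 2 ≠ 1) {I : LieIdeal K (FreeGraded K G)}
    (hI : ContainsConsequences g I) (hle : I ≤ gradedId (Gamma K g g⁻¹)) :
    gradedId (Gamma K g g⁻¹) = I := by
  refine le_antisymm (fun f hf => ?_) hle
  let B := Module.Basis.ofVectorSpace K (FreeLieAlgebra K ℕ ⧸ (ordinaryId K (UT 2 K)).toSubmodule)
  choose β hβ using fun t => (ordinaryId K (UT 2 K)).toSubmodule.mkQ_surjective (B t)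
  have hspan := hI.span_basisFamily (ne_inv_of_sq hg) (b := β)
    (by simp only [hβ]; exact B.span_eq) f
  have hind := linearIndependent_basisFamily hg (β := β)
    (by simp only [hβ]; exact B.linearIndependent)
  obtain ⟨c, hc⟩ := (Finsupp.mem_span_range_iff_exists_finsupp).1 hspan
  have hmem : c.sum (fun t r => r • basisFamily K g β t) - f ∈ I := by
    rw [← quotientHom_eq, ← hc]
    simp [Finsupp.sum]
  have hmem' := sub_mem (hle hmem) (neg_mem hf)
  rw [sub_neg_eq_add, sub_add_cancel] at hmem'
  have hc0 : c = 0 := by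
    refine linearIndependent_iff.1 hind c ?_
    rw [Finsupp.linearCombination_apply]
    have := (Submodule.Quotient.mk_eq_zero (gradedId (Gamma K g g⁻¹)).toSubmodule).2 hmem'
    rw [← Submodule.mkQ_apply] at this
    simpa [Finsupp.sum] using this
  rw [hc0] at hc
  exact quotientHom_eq_zero.1 (by simpa using hc.symm)

theorem isBasisModulo_basisFamily (hg : g ^ 2 ≠ 1) {ι : Type*} {b : ι → FreeLieAlgebra K ℕ}
    (hb : IsBasisModulo (ordinaryId K (UT 2 K)).toSubmodule b)
    (hI : ContainsConsequences g (gradedId (Gamma K g g⁻¹))) :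
    IsBasisModulo (gradedId (Gamma K g g⁻¹)).toSubmodule (basisFamily K g b) := by
  refine ⟨linearIndependent_basisFamily hg hb.1, Submodule.eq_top_iff'.2 fun u => ?_⟩
  obtain ⟨u, rfl⟩ := Submodule.mkQ_surjective _ u
  exact hI.span_basisFamily (ne_inv_of_sq hg) hb.2 u

end Conclusion

end GradedLiePI

theorem mainTheorem2 (K : Type*) [Field K] (G : Type*) [CommGroup G] (g : G) (hg : g ^ 2 ≠ 1) :
    (Infinite K → GradedLiePI.gradedId (GradedLiePI.Gamma K g g⁻¹) =
      GradedLiePI.tIdealSpan (GradedLiePI.generators K g)) ∧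
    (Finite K → GradedLiePI.gradedId (GradedLiePI.Gamma K g g⁻¹) =
      GradedLiePI.tIdealSpan
        (GradedLiePI.generators K g ∪ GradedLiePI.finiteGenerators K g (Nat.card K))) ∧
    (∀ (ι : Type*) (b : ι → FreeLieAlgebra K ℕ),
      GradedLiePI.IsBasisModulo (GradedLiePI.ordinaryId K (GradedLiePI.UT 2 K)).toSubmodule b →
      GradedLiePI.IsBasisModulo (GradedLiePI.gradedId (GradedLiePI.Gamma K g g⁻¹)).toSubmodule
        (GradedLiePI.basisFamily K g b)) := by
  open GradedLiePI in
  have hgen := generators_subset_gradedId (K := K) hg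
  have hfin := fun hK : Finite K => finiteGenerators_subset_gradedId (K := K) hg
  have hT : IsTIdeal (gradedId (Gamma K g g⁻¹)) := isTIdeal_gradedId
  have hInf : Infinite K → gradedId (Gamma K g g⁻¹) = tIdealSpan (generators K g) := fun _ =>
    gradedId_eq_of_containsConsequences hg
      (containsConsequences_tIdealSpan hg subset_rfl fun hK => (not_finite K).elim)
      (tIdealSpan_le hT hgen)
  have hFin : Finite K → gradedId (Gamma K g g⁻¹) =
      tIdealSpan (generators K g ∪ finiteGenerators K g (Nat.card K)) := fun hK =>
    gradedId_eq_of_containsConsequences hg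
      (containsConsequences_tIdealSpan hg Set.subset_union_left fun _ => Set.subset_union_right)
      (tIdealSpan_le hT (Set.union_subset hgen (hfin hK)))
  refine ⟨hInf, hFin, fun ι b hb => isBasisModulo_basisFamily hg hb ?_⟩
  rcases finite_or_infinite K with hK | hK
  · rw [hFin hK]
    exact containsConsequences_tIdealSpan hg Set.subset_union_left fun _ => Set.subset_union_right
  · rw [hInf hK]
    exact containsConsequences_tIdealSpan hg subset_rfl fun _ => (not_finite K).elim
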